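/- Consider a finite implicit-deadline sporadic task system $\tau_1,\dots,\tau_n$. Task $\tau_i$ has worst-case execution time $C_i>0$, minimum inter-arrival time (period) $T_i>0$, relative deadline $D_i=T_i$ and utilization $U_i=C_i/T_i$; consecutive releases of $\tau_i$ are at least $T_i$ apart, each of its jobs executes for at most $C_i$ time units and has to finish within $D_i$ time units after its release, and the jobs of one task are executed in sequence. The system is scheduled by preemptive global rate-monotonic (RM) scheduling on $M\ge 1$ identical processors: tasks with smaller periods have higher priority (ties are broken by a fixed arbitrary order), and at any time the $M$ highest-priority ready jobs (all ready jobs, if there are fewer than $M$) are executed. A task is schedulable if, for all legal release patterns and execution times of the jobs of the system, all of its jobs finish by their deadlines. Let $\tau_k$ be a task, let $hp(\tau_k)$ be the set of the tasks with higher priority than $\tau_k$, and suppose that all tasks in $hp(\tau_k)$ are schedulable by global RM on $M$ processors. Then $\tau_k$ is schedulable by global RM on $M$ processors if $$\Bigl(\frac{C_k}{T_k}+2\Bigr)\prod_{\tau_i\in hp(\tau_k)}\Bigl(\frac{U_i}{M}+1\Bigr)\le 3,$$ or if $$\sum_{\tau_i\in hp(\tau_k)}\frac{U_i}{M}\le\ln\frac{3}{\frac{C_k}{T_k}+2}.$$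 -/

import Mathlib

/-- A sporadic task system with `n` tasks: worst-case execution times `C i`, minimum inter-arrival
times (periods) `T i` and relative deadlines `D i`. -/
structure SporadicTaskSystem (n : ℕ) where
  C : Fin n → ℝ
  T : Fin n → ℝ
  D : Fin n → ℝ
  C_pos : ∀ i, 0 < C i
  T_pos : ∀ i, 0 < T i
  D_pos : ∀ i, 0 < D i

namespace SporadicTaskSystem

variable {n : ℕ}

/-- The utilization `U i = C i / T i`. -/
noncomputable def U (S : SporadicTaskSystem n) (i : Fin n) : ℝ := S.C i / S.T i

/-- Implicit deadlines: relative deadlines equal periods. -/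
def ImplicitDeadline (S : SporadicTaskSystem n) : Prop := ∀ i, S.D i = S.T i

/-- The index order is a rate-monotonic priority order, a smaller index meaning a higher priority:
a task of smaller period has a higher priority, and ties are broken arbitrarily (by the index). -/
def RateMonotonic (S : SporadicTaskSystem n) : Prop := ∀ i j, S.T i < S.T j → i < j

/-- A job is a pair `(i, j)`: the `j`-th job of the task with index `i`. -/
abbrev Job (n : ℕ) : Type := Fin n × ℕ

/-- A legal behaviour of the task system: release times respecting the minimum inter-arrival
times, and actual execution times bounded by the worst-case execution times. -/
structure Behaviour (S : SporadicTaskSystem n) where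
  release : Job n → ℝ
  exec : Job n → ℝ
  release_nonneg : ∀ J, 0 ≤ release J
  release_sep : ∀ i j, release (i, j) + S.T i ≤ release (i, j + 1)
  exec_pos : ∀ J, 0 < exec J
  exec_le : ∀ J, exec J ≤ S.C J.1

/-- A schedule on `M` processors: `σ p t` is the job executed by processor `p` at time `t`, or
`none` if the processor is idle. -/
abbrev Schedule (n M : ℕ) : Type := Fin M → ℝ → Option (Job n)

namespace Schedule

variable {M : ℕ}

/-- Job `J` is executed at time `t` (on some processor). -/
def Runs (σ : Schedule n M) (J : Job n) (t : ℝ) : Prop := ∃ p, σ p t = some J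

/-- The amount of execution that job `J` receives in the time interval `[0, t)`. -/
noncomputable def service (σ : Schedule n M) (J : Job n) (t : ℝ) : ℝ :=
  MeasureTheory.volume.real {s : ℝ | 0 ≤ s ∧ s < t ∧ σ.Runs J s}

end Schedule

namespace Behaviour

variable {M : ℕ} {S : SporadicTaskSystem n}

/-- Job `J` has finished by time `t`. -/
def Finished (B : S.Behaviour) (σ : Schedule n M) (J : Job n) (t : ℝ) : Prop :=
  B.exec J ≤ σ.service J t

/-- Job `J` is in the ready queue at time `t`: it has been released, it has not finished, and all
earlier jobs of the same task have finished. -/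
def Ready (B : S.Behaviour) (σ : Schedule n M) (J : Job n) (t : ℝ) : Prop :=
  B.release J ≤ t ∧ ¬ B.Finished σ J t ∧ ∀ j < J.2, B.Finished σ (J.1, j) t

/-- `σ` is the preemptive global fixed-priority schedule of the behaviour on `M` identical
processors: at each time the `M` highest-priority ready jobs (all of them if there are
fewer) are executed. At most one job per task is ready at any time, so comparing the tasks' indices
compares the priorities of ready jobs. -/
structure IsGlobalFixedPriority (B : S.Behaviour) (σ : Schedule n M) : Prop where
  measurable : ∀ J, MeasurableSet {t : ℝ | σ.Runs J t}
  /-- No job is executed on two processors at the same time. -/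
  no_parallel : ∀ p q t J, σ p t = some J → σ q t = some J → p = q
  /-- Only ready jobs are executed. -/
  ready_of_runs : ∀ J t, σ.Runs J t → B.Ready σ J t
  /-- A ready job waits only if every processor executes a job of higher priority. -/
  work_conserving : ∀ J t, B.Ready σ J t → ¬ σ.Runs J t →
    ∀ p, ∃ J', σ p t = some J' ∧ J'.1 < J.1

end Behaviour

/-- Task `i` is schedulable on `M` identical processors by global preemptive fixed-priority
scheduling, the priorities being given by the indices: whatever the legal behaviour of the
system, every job of task `i` finishes by its absolute deadline. -/
def Schedulable (S : SporadicTaskSystem n) (M : ℕ) (i : Fin n) : Prop :=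
  ∀ (B : S.Behaviour) (σ : Schedule n M), B.IsGlobalFixedPriority σ →
    ∀ j : ℕ, B.Finished σ (i, j) (B.release (i, j) + S.D i)

end SporadicTaskSystem

open MeasureTheory

/-! While an unfinished job of `k` waits, all `M` processors serve higher-priority jobs.
Schedulability of those tasks leaves each at most one carry-in job, so a missed deadline forces `M *
(t - C k) < ∑ (⌈t / T i⌉ + 1) * C i` for every `t` in `[0, T k]` (`mul_sub_lt_of_not_finished`).

To refute this, let `x i` be the largest multiple of `T i` up to `T k`, and `u i = U i / M`. After
division by `M`, task `i` demands at most `2 * x i * u i` up to time `x i` and `3 * x i * u i` after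
it. With `Σ = ∑ x i * u i` and `a = C k + 2 * Σ`, failure at the times `x i` gives `a + Σ ≤ a * ∏ (u
i + 1)` (`add_sum_mul_le_mul_prod_add_one`). Failure at `T k` gives `T k < a + Σ`, hence `3 * a = C
k + 2 * (a + Σ) < (C k / T k + 2) * (a + Σ)`, contradicting the product bound. The logarithmic test
reduces to the product by `u + 1 ≤ exp u`. -/

/-- If every point of `N` is covered by at least `M` of the sets `A x`, then `M` times the measure
of `N` is at most the total measure of the sets `A x`. -/
theorem natCast_mul_measureReal_le_sum_of_le_card {ι α : Type*} [MeasurableSpace α]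
    {μ : Measure α} (M : ℕ) (F : Finset ι) (A : ι → Set α) (N : Set α)
    (hN : MeasurableSet N) (hNfin : μ N ≠ ⊤)
    (hA : ∀ x ∈ F, MeasurableSet (A x)) (hAfin : ∀ x ∈ F, μ (A x) ≠ ⊤)
    (hcover : ∀ s ∈ N, ∃ G ⊆ F, M ≤ G.card ∧ ∀ x ∈ G, s ∈ A x) :
    (M : ℝ) * μ.real N ≤ ∑ x ∈ F, μ.real (A x) := by
  have hint : ∀ x ∈ F, Integrable ((A x).indicator (1 : α → ℝ)) μ := fun x hx =>
    (integrable_indicator_iff (hA x hx)).2 (integrableOn_const (hAfin x hx))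
  have hintN : Integrable (N.indicator (1 : α → ℝ)) μ :=
    (integrable_indicator_iff hN).2 (integrableOn_const hNfin)
  calc (M : ℝ) * μ.real N = ∫ s, (M : ℝ) * N.indicator (1 : α → ℝ) s ∂μ := by
        rw [integral_const_mul, integral_indicator_one hN]
    _ ≤ ∫ s, ∑ x ∈ F, (A x).indicator (1 : α → ℝ) s ∂μ := by
        refine integral_mono (hintN.const_mul _) (integrable_finsetSum _ hint) fun s => ?_
        have hnonneg : ∀ x, 0 ≤ (A x).indicator (1 : α → ℝ) s := fun x =>
          Set.indicator_nonneg (fun _ _ => zero_le_one) s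
        by_cases hs : s ∈ N
        · obtain ⟨G, hGF, hG, hmem⟩ := hcover s hs
          calc (M : ℝ) * N.indicator (1 : α → ℝ) s = M := by simp [hs]
            _ ≤ G.card := by exact_mod_cast hG
            _ = ∑ x ∈ G, (A x).indicator (1 : α → ℝ) s := by
                rw [Finset.sum_congr rfl fun x hx => Set.indicator_of_mem (hmem x hx) _]
                simp
            _ ≤ _ := Finset.sum_le_sum_of_subset_of_nonneg hGF fun x _ _ => hnonneg x
        · simpa [hs] using Finset.sum_nonneg fun x (_ : x ∈ F) => hnonneg x
    _ = ∑ x ∈ F, μ.real (A x) := by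
        rw [integral_finsetSum _ hint]
        exact Finset.sum_congr rfl fun x hx => integral_indicator_one (hA x hx)

/-- If each `t i` is at most `a` plus the sum of `t j * u j` over the smaller `t j`, then
`a + ∑ t i * u i` is at most `a * ∏ (u i + 1)`. -/
theorem add_sum_mul_le_mul_prod_add_one {ι : Type*} (s : Finset ι) (t u : ι → ℝ)
    (a : ℝ) (ht : ∀ i ∈ s, 0 ≤ t i) (hu : ∀ i ∈ s, 0 ≤ u i)
    (h : ∀ i ∈ s, t i ≤ a + ∑ j ∈ s with t j < t i, t j * u j) :
    a + ∑ i ∈ s, t i * u i ≤ a * ∏ i ∈ s, (u i + 1) := by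
  classical
  induction s using Finset.induction_on_max_value t with
  | empty => simp
  | insert b s hb hmax ih =>
    have hu' : ∀ i ∈ s, 0 ≤ u i := fun i hi => hu i (Finset.mem_insert_of_mem hi)
    have ht' : ∀ i ∈ s, 0 ≤ t i := fun i hi => ht i (Finset.mem_insert_of_mem hi)
    have hub := hu b (Finset.mem_insert_self b s)
    -- `t b` is maximal and the filter is strict, so `b` occurs in none of the bounds.
    have hs := ih ht' hu' fun i hi => by
      have := h i (Finset.mem_insert_of_mem hi)
      rwa [Finset.filter_insert, if_neg (not_lt.2 (hmax i hi))] at this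
    have htb : t b ≤ a + ∑ j ∈ s, t j * u j := by
      refine (h b (Finset.mem_insert_self b s)).trans ?_
      rw [Finset.filter_insert, if_neg (lt_irrefl _)]
      exact add_le_add_right (Finset.sum_le_sum_of_subset_of_nonneg (Finset.filter_subset _ s)
        fun i hi _ => mul_nonneg (ht' i hi) (hu' i hi)) a
    rw [Finset.sum_insert hb, Finset.prod_insert hb]
    calc a + (t b * u b + ∑ j ∈ s, t j * u j)
        ≤ (a + ∑ j ∈ s, t j * u j) * (u b + 1) := by
          linarith [mul_le_mul_of_nonneg_right htb hub]
      _ ≤ a * (∏ j ∈ s, (u j + 1)) * (u b + 1) := by gcongr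
      _ = _ := by ring

/-- The indices at which a sequence with gaps at least `T` takes values in an open interval of
length `t + T` lie in a finite set of at most `⌈t / T⌉ + 1` indices. -/
theorem exists_finset_card_le_of_separated {T t c : ℝ} (hT : 0 < T) (r : ℕ → ℝ)
    (hr : ∀ j, r j + T ≤ r (j + 1)) :
    ∃ w : Finset ℕ, w.card ≤ ⌈t / T⌉₊ + 1 ∧ ∀ j, c - T < r j → r j < c + t → j ∈ w := by
  classical
  have hsep : ∀ j d, r j + d * T ≤ r (j + d) := by
    intro j d
    induction d with
    | zero => simp
    | succ d ih =>
      have := hr (j + d)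
      push_cast
      rw [← add_assoc]
      linarith
  by_cases hex : ∃ j, c - T < r j
  · refine ⟨Finset.Ico (Nat.find hex) (Nat.find hex + (⌈t / T⌉₊ + 1)), by simp, ?_⟩
    intro j hj hj'
    have hle : Nat.find hex ≤ j := Nat.find_min' hex hj
    obtain ⟨d, hd⟩ := Nat.exists_eq_add_of_le hle
    have h1 := hsep (Nat.find hex) d
    rw [← hd] at h1
    have h2 := Nat.find_spec hex
    -- The first index in range lies above `c - T` and the index `d` later lies below `c + t`, at
    -- least `d * T` further on.
    have h3 : ((d : ℝ) - 1) * T < t := by linarith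
    have h4 : (d : ℝ) - 1 < ⌈t / T⌉₊ := ((lt_div_iff₀ hT).2 h3).trans_le (Nat.le_ceil _)
    have h5 : d < ⌈t / T⌉₊ + 1 := by
      have : (d : ℝ) < ((⌈t / T⌉₊ + 1 : ℕ) : ℝ) := by push_cast; linarith
      exact_mod_cast this
    rw [Finset.mem_Ico]
    omega
  · exact ⟨∅, by simp, fun j hj _ => (hex ⟨j, hj⟩).elim⟩

namespace SporadicTaskSystem

variable {n M : ℕ} {S : SporadicTaskSystem n}

theorem RateMonotonic.period_le (hRM : S.RateMonotonic) {i k : Fin n} (hik : i < k) :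
    S.T i ≤ S.T k :=
  not_lt.1 fun h => (hRM k i h).asymm hik

/-! ### Service as a function of time -/

namespace Schedule

variable (σ : Schedule n M) (J : Job n)

theorem volume_runs_inter_ne_top (a b : ℝ) :
    volume {s : ℝ | a ≤ s ∧ s < b ∧ σ.Runs J s} ≠ ⊤ :=
  measure_ne_top_of_subset (s := Set.Ico a b) (fun _ hs => ⟨hs.1, hs.2.1⟩)
    measure_Ico_lt_top.ne

theorem service_mono : Monotone (σ.service J) := by
  intro a b hab
  refine measureReal_mono ?_ (σ.volume_runs_inter_ne_top J 0 b)
  exact fun s hs => ⟨hs.1, hs.2.1.trans_le hab, hs.2.2⟩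

theorem service_le_add {a b : ℝ} (hab : a ≤ b) :
    σ.service J b ≤ σ.service J a + (b - a) := by
  calc σ.service J b
      ≤ volume.real ({s : ℝ | 0 ≤ s ∧ s < a ∧ σ.Runs J s} ∪ Set.Ico a b) := by
        refine measureReal_mono (fun s hs => ?_) ?_
        · rcases lt_or_ge s a with h | h
          · exact Or.inl ⟨hs.1, h, hs.2.2⟩
          · exact Or.inr ⟨h, hs.2.1⟩
        · exact (measure_union_lt_top (σ.volume_runs_inter_ne_top J 0 a).lt_top
            measure_Ico_lt_top).ne
    _ ≤ _ := measureReal_union_le _ _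
    _ = σ.service J a + (b - a) := by rw [Real.volume_real_Ico_of_le hab]; rfl

/-- Service grows at rate at most one. Continuity provides an instant at which a job has received
exactly its execution time. -/
theorem continuous_service : Continuous (σ.service J) := by
  refine LipschitzWith.continuous (K := 1) (LipschitzWith.of_le_add fun a b => ?_)
  rcases le_total a b with h | h
  · exact (σ.service_mono J h).trans (le_add_of_nonneg_right dist_nonneg)
  · rw [Real.dist_eq, abs_of_nonneg (sub_nonneg.2 h)]
    exact σ.service_le_add J h

theorem service_zero : σ.service J 0 = 0 := by
  have : {s : ℝ | 0 ≤ s ∧ s < 0 ∧ σ.Runs J s} = ∅ := by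
    ext s
    simpa using fun h h' => absurd h' (not_lt.2 h)
  simp [service, this]

end Schedule

/-! ### Interference of higher-priority tasks -/

namespace Behaviour

variable {B : S.Behaviour} {σ : Schedule n M}

theorem Finished.mono {J : Job n} {a b : ℝ} (h : B.Finished σ J a) (hab : a ≤ b) :
    B.Finished σ J b :=
  le_trans h (σ.service_mono J hab)

theorem release_add_le_of_lt (i : Fin n) {j l : ℕ} (hjl : j < l) :
    B.release (i, j) + S.T i ≤ B.release (i, l) := by
  have hmono : Monotone fun j => B.release (i, j) := monotone_nat_of_le_succ fun j => by
    linarith [B.release_sep i j, S.T_pos i]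
  exact (B.release_sep i j).trans (hmono hjl)

/-- A job never receives more service than its execution time. -/
theorem IsGlobalFixedPriority.service_le (hσ : B.IsGlobalFixedPriority σ) (J : Job n)
    {t : ℝ} (ht : 0 ≤ t) : σ.service J t ≤ B.exec J := by
  by_contra! hlt
  obtain ⟨v, hv, hve⟩ := intermediate_value_Icc ht (σ.continuous_service J).continuousOn
    (show B.exec J ∈ Set.Icc _ _ from
      ⟨by rw [σ.service_zero J]; exact (B.exec_pos J).le, hlt.le⟩)
  -- From `v` on the job counts as finished, so it is never ready and never runs.
  have hsub : σ.service J t ≤ σ.service J v :=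
    measureReal_mono (fun s hs => ⟨hs.1, lt_of_not_ge fun hvs =>
      (hσ.ready_of_runs J s hs.2.2).2.1 (hve.ge.trans (σ.service_mono J hvs)), hs.2.2⟩)
      (σ.volume_runs_inter_ne_top J 0 v)
  linarith

theorem IsGlobalFixedPriority.measurableSet_runs_inter (hσ : B.IsGlobalFixedPriority σ)
    (J : Job n) (a b : ℝ) : MeasurableSet {s : ℝ | a ≤ s ∧ s < b ∧ σ.Runs J s} := by
  have : {s : ℝ | a ≤ s ∧ s < b ∧ σ.Runs J s} = Set.Ico a b ∩ {s | σ.Runs J s} := by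
    ext s
    simp [and_assoc]
  rw [this]
  exact measurableSet_Ico.inter (hσ.measurable J)

/-- If a job of task `k` whose predecessors are finished at its release is unfinished `t` time
units later, then the interference of the higher-priority tasks, each contributing at most one
carry-in job, exceeds the capacity of the `M` processors. -/
theorem IsGlobalFixedPriority.mul_sub_lt_of_not_finished (hσ : B.IsGlobalFixedPriority σ)
    (hM : 0 < M) (himplicit : S.ImplicitDeadline) {k : Fin n}
    (hhp : ∀ i, i < k → S.Schedulable M i) {j : ℕ}
    (hprev : ∀ l < j, B.Finished σ (k, l) (B.release (k, j))) {t : ℝ} (ht : 0 ≤ t)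
    (hunfin : ¬ B.Finished σ (k, j) (B.release (k, j) + t)) :
    M * (t - S.C k) < ∑ i with i < k, ((⌈t / S.T i⌉₊ + 1 : ℕ) : ℝ) * S.C i := by
  set r := B.release (k, j) with hr
  have hr0 : 0 ≤ r := B.release_nonneg _
  choose w hwcard hw using fun i : Fin n => exists_finset_card_le_of_separated (t := t) (c := r)
    (S.T_pos i) (fun l => B.release (i, l)) (B.release_sep i)
  have hmem : ∀ i l s, i < k → r ≤ s → s < r + t → σ.Runs (i, l) s → l ∈ w i := by
    intro i l s hik hrs hst hrun
    obtain ⟨hrel, hnf, -⟩ := hσ.ready_of_runs _ _ hrun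
    refine hw i l ?_ (hrel.trans_lt hst)
    -- A job released by `r - T i` has its deadline by `r`, hence is finished before the window.
    by_contra! hle
    refine hnf ((hhp i hik B σ hσ l).mono ?_)
    rw [himplicit i]
    linarith
  set R : Set ℝ := {s | r ≤ s ∧ s < r + t ∧ σ.Runs (k, j) s} with hR
  set F : Finset (Σ _ : Fin n, ℕ) := (Finset.univ.filter (· < k)).sigma w with hF
  set A : (Σ _ : Fin n, ℕ) → Set ℝ :=
    fun x => {s | r ≤ s ∧ s < r + t ∧ σ.Runs (x.1, x.2) s} with hA
  have hsub : ∀ J : Job n,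
      volume.real {s | r ≤ s ∧ s < r + t ∧ σ.Runs J s} ≤ σ.service J (r + t) := fun J =>
    measureReal_mono (fun s hs => ⟨hr0.trans hs.1, hs.2⟩) (σ.volume_runs_inter_ne_top J 0 _)
  have hRm : MeasurableSet R := hσ.measurableSet_runs_inter _ _ _
  have hRlt : volume.real R < S.C k :=
    ((hsub _).trans_lt (not_le.1 hunfin)).trans_le (B.exec_le _)
  have hidle : t - S.C k < volume.real (Set.Ico r (r + t) \ R) := by
    have hRsub : R ⊆ Set.Ico r (r + t) := fun s hs => ⟨hs.1, hs.2.1⟩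
    rw [measureReal_sdiff hRsub hRm measure_Ico_lt_top.ne,
      Real.volume_real_Ico_of_le (by linarith)]
    linarith
  have hcount : (M : ℝ) * volume.real (Set.Ico r (r + t) \ R) ≤ ∑ x ∈ F, volume.real (A x) := by
    refine natCast_mul_measureReal_le_sum_of_le_card M F A _ (measurableSet_Ico.diff hRm)
      (measure_ne_top_of_subset Set.sdiff_subset measure_Ico_lt_top.ne)
      (fun x _ => hσ.measurableSet_runs_inter _ _ _)
      (fun x _ => σ.volume_runs_inter_ne_top _ _ _) ?_
    rintro s ⟨⟨hrs, hst⟩, hsR⟩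
    have hready : B.Ready σ (k, j) s :=
      ⟨hrs, fun h => hunfin (h.mono hst.le), fun l hl => (hprev l hl).mono hrs⟩
    choose J hJ hJlt using hσ.work_conserving _ _ hready fun hrun => hsR ⟨hrs, hst, hrun⟩
    -- Distinct processors run distinct jobs, so the waiting instant `s` is covered `M` times.
    have hinj : Function.Injective fun p => (⟨(J p).1, (J p).2⟩ : Σ _ : Fin n, ℕ) := by
      intro p q hpq
      have hpq' : J p = J q := by
        simp only [Sigma.mk.injEq, heq_eq_eq] at hpq
        exact Prod.ext hpq.1 hpq.2
      exact hσ.no_parallel p q s (J p) (hJ p) (hpq' ▸ hJ q)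
    refine ⟨Finset.univ.map ⟨_, hinj⟩, ?_, by simp, ?_⟩
    · intro x hx
      obtain ⟨p, -, rfl⟩ := Finset.mem_map.1 hx
      simp only [hF, Finset.mem_sigma, Finset.mem_filter_univ, Function.Embedding.coeFn_mk]
      exact ⟨hJlt p, hmem _ _ s (hJlt p) hrs hst ⟨p, hJ p⟩⟩
    · intro x hx
      obtain ⟨p, -, rfl⟩ := Finset.mem_map.1 hx
      exact ⟨hrs, hst, p, hJ p⟩
  calc M * (t - S.C k) < M * volume.real (Set.Ico r (r + t) \ R) := by gcongr
    _ ≤ ∑ x ∈ F, volume.real (A x) := hcount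
    _ ≤ ∑ x ∈ F, S.C x.1 := Finset.sum_le_sum fun x _ =>
        (hsub _).trans ((hσ.service_le _ (by linarith)).trans (B.exec_le _))
    _ = ∑ i with i < k, ((w i).card : ℝ) * S.C i := by
        rw [hF, Finset.sum_sigma]
        simp
    _ ≤ _ := Finset.sum_le_sum fun i _ =>
        mul_le_mul_of_nonneg_right (by exact_mod_cast hwcard i) (S.C_pos i).le

end Behaviour

/-! ### From the interference test to the hyperbolic bound -/

/-- Task `k` is schedulable if its execution time and the interference of the higher-priority
tasks fit into some window no longer than its period. -/
theorem schedulable_of_exists_time (hM : 0 < M) (himplicit : S.ImplicitDeadline) {k : Fin n}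
    (hhp : ∀ i, i < k → S.Schedulable M i)
    (htest : ∃ t, 0 ≤ t ∧ t ≤ S.T k ∧
      ∑ i with i < k, ((⌈t / S.T i⌉₊ + 1 : ℕ) : ℝ) * S.C i ≤ M * (t - S.C k)) :
    S.Schedulable M k := by
  intro B σ hσ j
  obtain ⟨t, ht, htk, hle⟩ := htest
  induction j using Nat.strong_induction_on with
  | _ j ih =>
    by_contra hunfin
    refine (hσ.mul_sub_lt_of_not_finished hM himplicit hhp (j := j) (fun l hl => ?_) ht
      fun h => hunfin (h.mono ?_)).not_ge hle
    -- Each predecessor meets its deadline, which is no later than the release of job `j`.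
    · refine (ih l hl).mono ?_
      rw [himplicit k]
      exact Behaviour.release_add_le_of_lt k hl
    · rw [himplicit k]
      gcongr

/-- The hyperbolic bound guarantees a window passing the interference test. -/
theorem exists_time_of_prod_le (hM : 0 < M) (hRM : S.RateMonotonic) (k : Fin n)
    (hprod : (S.C k / S.T k + 2) * ∏ i with i < k, (S.U i / M + 1) ≤ 3) :
    ∃ t, 0 ≤ t ∧ t ≤ S.T k ∧
      ∑ i with i < k, ((⌈t / S.T i⌉₊ + 1 : ℕ) : ℝ) * S.C i ≤ M * (t - S.C k) := by
  by_contra! hfail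
  have hM' : (0 : ℝ) < M := by exact_mod_cast hM
  have hTk := S.T_pos k
  have hCk := S.C_pos k
  set m : Fin n → ℕ := fun i => ⌊S.T k / S.T i⌋₊ with hm
  set x : Fin n → ℝ := fun i => m i * S.T i with hx
  set u : Fin n → ℝ := fun i => S.U i / M with hu
  have hx0 : ∀ i, 0 ≤ x i := fun i => mul_nonneg (Nat.cast_nonneg _) (S.T_pos i).le
  have hu0 : ∀ i, 0 ≤ u i := fun i =>
    div_nonneg (div_nonneg (S.C_pos i).le (S.T_pos i).le) hM'.le
  have hxk : ∀ i, x i ≤ S.T k := fun i =>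
    (le_div_iff₀ (S.T_pos i)).1 (Nat.floor_le (div_nonneg hTk.le (S.T_pos i).le))
  have hm1 : ∀ i, i < k → 1 ≤ m i := fun i hik =>
    Nat.le_floor (by rw [Nat.cast_one, one_le_div (S.T_pos i)]; exact hRM.period_le hik)
  have hxu : ∀ i, x i * u i = m i * S.C i / M := fun i => by
    have := (S.T_pos i).ne'
    simp only [hx, hu, U]
    field_simp
  set a : ℝ := S.C k + 2 * ∑ i with i < k, x i * u i with ha
  have hsum0 : 0 ≤ ∑ i with i < k, x i * u i :=
    Finset.sum_nonneg fun i _ => mul_nonneg (hx0 i) (hu0 i)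
  have hterm : ∀ t, t ≤ S.T k → ∀ i, i < k →
      ((⌈t / S.T i⌉₊ + 1 : ℕ) : ℝ) * S.C i ≤
        M * (2 * (x i * u i) + if x i < t then x i * u i else 0) := by
    intro t htk i hik
    have hCi := S.C_pos i
    have h1 : (1 : ℝ) ≤ m i := by exact_mod_cast hm1 i hik
    rw [hxu]
    -- The job count is at most `m i + 2` after `x i` and `m i + 1` up to it. Since `1 ≤ m i`, these
    -- are at most `3 * m i` and `2 * m i`; the carry-in job is thus charged to `x i * u i`.
    split_ifs with hlt
    · have hceil : ⌈t / S.T i⌉₊ ≤ m i + 1 :=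
        (Nat.ceil_mono (div_le_div_of_nonneg_right htk (S.T_pos i).le)).trans
          (Nat.ceil_le_floor_add_one _)
      have hceil' : ((⌈t / S.T i⌉₊ + 1 : ℕ) : ℝ) ≤ 3 * m i := by
        have : ((⌈t / S.T i⌉₊ : ℕ) : ℝ) ≤ m i + 1 := by exact_mod_cast hceil
        push_cast
        linarith
      calc _ ≤ 3 * m i * S.C i := by gcongr
        _ = _ := by field_simp; ring
    · have hceil : ⌈t / S.T i⌉₊ ≤ m i :=
        Nat.ceil_le.2 ((div_le_iff₀ (S.T_pos i)).2 (not_lt.1 hlt))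
      have hceil' : ((⌈t / S.T i⌉₊ + 1 : ℕ) : ℝ) ≤ 2 * m i := by
        have : ((⌈t / S.T i⌉₊ : ℕ) : ℝ) ≤ m i := by exact_mod_cast hceil
        push_cast
        linarith
      calc _ ≤ 2 * m i * S.C i := by gcongr
        _ = _ := by field_simp; ring
  have hpoint : ∀ t, 0 ≤ t → t ≤ S.T k →
      t < a + ∑ i ∈ Finset.univ.filter (· < k) with x i < t, x i * u i := by
    intro t ht htk
    have h := (hfail t ht htk).trans_le (Finset.sum_le_sum fun i hi =>
      hterm t htk i (Finset.mem_filter_univ i |>.1 hi))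
    rw [← Finset.mul_sum, Finset.sum_add_distrib, ← Finset.mul_sum, ← Finset.sum_filter] at h
    have := lt_of_mul_lt_mul_left h hM'.le
    linarith
  have hbound := add_sum_mul_le_mul_prod_add_one (Finset.univ.filter fun i => i < k) x u a
    (fun i _ => hx0 i) (fun i _ => hu0 i) fun i _ => (hpoint (x i) (hx0 i) (hxk i)).le
  have hend : S.T k < a + ∑ i with i < k, x i * u i :=
    (hpoint _ hTk.le le_rfl).trans_le (add_le_add_right
      (Finset.sum_le_sum_of_subset_of_nonneg (Finset.filter_subset _ _)
        fun i _ _ => mul_nonneg (hx0 i) (hu0 i)) a)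
  have hq : 0 < S.C k / S.T k := div_pos hCk hTk
  have ha0 : 0 < a := by linarith
  have hCk' : S.C k = S.C k / S.T k * S.T k := (div_mul_cancel₀ _ hTk.ne').symm
  have h1 : S.C k < S.C k / S.T k * (a + ∑ i with i < k, x i * u i) :=
    hCk'.trans_lt (mul_lt_mul_of_pos_left hend hq)
  -- By the choice of `a`, `3 * a` equals `C k` plus twice `a + ∑ x i * u i`; `h1` bounds the `C k`
  -- term.
  have h2 : 3 * a < (S.C k / S.T k + 2) * (a + ∑ i with i < k, x i * u i) := by
    rw [add_mul]
    linarith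
  have h3 := mul_le_mul_of_nonneg_left hbound (by linarith : 0 ≤ S.C k / S.T k + 2)
  have h4 := mul_le_mul_of_nonneg_right hprod ha0.le
  linarith

end SporadicTaskSystem

/-- A bound on the sum by a logarithm implies the corresponding bound on the product. -/
theorem mul_prod_add_one_le_of_sum_le_log {ι : Type*} (s : Finset ι) (u : ι → ℝ) {b c : ℝ}
    (hb : 0 < b) (hc : 0 < c) (hu : ∀ i ∈ s, 0 ≤ u i)
    (h : ∑ i ∈ s, u i ≤ Real.log (c / b)) : b * ∏ i ∈ s, (u i + 1) ≤ c := by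
  have : ∏ i ∈ s, (u i + 1) ≤ c / b := by
    calc ∏ i ∈ s, (u i + 1) ≤ ∏ i ∈ s, Real.exp (u i) :=
          Finset.prod_le_prod (fun i hi => by linarith [hu i hi])
            fun i _ => Real.add_one_le_exp _
      _ = Real.exp (∑ i ∈ s, u i) := (Real.exp_sum _ _).symm
      _ ≤ Real.exp (Real.log (c / b)) := Real.exp_le_exp.2 h
      _ = c / b := Real.exp_log (div_pos hc hb)
  rwa [le_div_iff₀' hb] at this

theorem mainTheorem9 (n M : ℕ) (hM : 0 < M) (S : SporadicTaskSystem n)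
    (himplicit : S.ImplicitDeadline) (hRM : S.RateMonotonic) (k : Fin n)
    (hhp : ∀ i, i < k → S.Schedulable M i)
    (hcond : (S.C k / S.T k + 2) * ∏ i ∈ Finset.univ.filter (fun i => i < k), (S.U i / M + 1) ≤ 3 ∨
      ∑ i ∈ Finset.univ.filter (fun i => i < k), S.U i / M ≤
        Real.log (3 / (S.C k / S.T k + 2))) :
    S.Schedulable M k := by
  refine SporadicTaskSystem.schedulable_of_exists_time hM himplicit hhp
    (SporadicTaskSystem.exists_time_of_prod_le hM hRM k (hcond.elim id fun hlog => ?_))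
  refine mul_prod_add_one_le_of_sum_le_log _ _ ?_ three_pos (fun i _ => ?_) hlog
  · have := div_pos (S.C_pos k) (S.T_pos k)
    positivity
  · exact div_nonneg (div_nonneg (S.C_pos i).le (S.T_pos i).le) (Nat.cast_nonneg M)
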